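/- A \emph{product state} of $\mathbb{C}^n\otimes\mathbb{C}^m$ is a vector $a\otimes b$ with unit vectors $a\in\mathbb{C}^n$, $b\in\mathbb{C}^m$. An \emph{unextendible product basis} (UPB) of $\mathbb{C}^n\otimes\mathbb{C}^m$ is an orthonormal family of $k<nm$ product states $\phi_1,\dots,\phi_k$ such that no product state is orthogonal to all of $\phi_1,\dots,\phi_k$; its \emph{missing states number} is $nm-k$. \textbf{Theorem.} Let $n,m$ be integers with $7\le n\le m\le n+1$. Then for every integer $t$ with $4\le t\le\lfloor mn/2\rfloor+1$ there is a UPB of $\mathbb{C}^n\otimes\mathbb{C}^m$ with missing states number $t$. -/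

import Mathlib

open scoped TensorProduct

/-- The bipartite Hilbert space `ℂⁿ ⊗ ℂᵐ`; its inner product is determined by
`⟪a ⊗ b, c ⊗ d⟫ = ⟪a, c⟫ * ⟪b, d⟫`. -/
abbrev Bipartite (n m : ℕ) : Type :=
  EuclideanSpace ℂ (Fin n) ⊗[ℂ] EuclideanSpace ℂ (Fin m)

/-- A product state: a tensor product `a ⊗ b` of unit vectors. -/
def IsProductState {n m : ℕ} (ψ : Bipartite n m) : Prop :=
  ∃ (a : EuclideanSpace ℂ (Fin n)) (b : EuclideanSpace ℂ (Fin m)),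
    ‖a‖ = 1 ∧ ‖b‖ = 1 ∧ ψ = a ⊗ₜ[ℂ] b

/-- A `k`-member unextendible product basis of `ℂⁿ ⊗ ℂᵐ`. -/
structure IsUPB {n m k : ℕ} (φ : Fin k → Bipartite n m) : Prop where
  card_lt : k < n * m
  isProductState : ∀ i, IsProductState (φ i)
  orthonormal : Orthonormal ℂ φ
  unextendible : ∀ ψ : Bipartite n m, (∀ i, inner ℂ (φ i) ψ = 0) → ¬ IsProductState ψ

/-- The missing states number `nm - k` of a family of `k` states in `ℂⁿ ⊗ ℂᵐ`. It is used for
unextendible product bases only, where `k < nm`, so the subtraction does not truncate. -/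
def missingStatesNumber {n m k : ℕ} (_φ : Fin k → Bipartite n m) : ℕ := n * m - k

/-! Unextendible product families can be placed side by side. If `ℂ^(n+n') ⊗ ℂ^m` is cut into two
blocks with a family in each, the union is unextendible and the missing numbers add
(`HasMissing.sum`). A block filled with the standard basis contributes 0, so every missing number
survives enlargement (`HasMissing.mono`). It remains to add up small blocks, given by explicit
integer vectors and checked by exact computation. A block realising every value from 8 up to some S
≥ 11 contains four consecutive values, so it can be joined to a block whose known values have gaps
of at most 4 without leaving a hole (`FillsUpTo.add_rows`). The 4 × m blocks reach at least half
their dimension (`denseUpTo_four`), so adding four rows or columns preserves the bound nm/2 + 1.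
This reduces everything to sides 7 to 10 (`fillsHalf_of_le`). The values 4 to 8 already occur in 4 ×
4. -/

/-! ### Unnormalised unextendible product families -/

/-- There is a family of `|α| * |β| - t` pairwise orthogonal nonzero product vectors `a i ⊗ b i` in
`ℂ^α ⊗ ℂ^β` such that no nonzero product vector is orthogonal to all of them. -/
def HasMissing (α β : Type) [Fintype α] [Fintype β] (t : ℕ) : Prop :=
  ∃ (ι : Type) (_ : Fintype ι) (a : ι → α → ℂ) (b : ι → β → ℂ),
    Fintype.card ι + t = Fintype.card α * Fintype.card β ∧
    (∀ i, a i ≠ 0 ∧ b i ≠ 0) ∧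
    (∀ i j, i ≠ j → star (a i) ⬝ᵥ a j = 0 ∨ star (b i) ⬝ᵥ b j = 0) ∧
    ∀ x y, (∀ i, star (a i) ⬝ᵥ x = 0 ∨ star (b i) ⬝ᵥ y = 0) → x = 0 ∨ y = 0

namespace HasMissing

variable {α β γ α' : Type} [Fintype α] [Fintype β] [Fintype γ] [Fintype α'] {s t : ℕ}

theorem swap (h : HasMissing α β t) : HasMissing β α t := by
  obtain ⟨ι, _, a, b, hc, h0, ho, hu⟩ := h
  exact ⟨ι, _, b, a, by rw [hc, mul_comm], fun i => (h0 i).symm, fun i j hij => (ho i j hij).symm,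
    fun x y hxy => (hu y x fun i => (hxy i).symm).symm⟩

theorem congr_left (e : α ≃ α') (h : HasMissing α β t) : HasMissing α' β t := by
  obtain ⟨ι, _, a, b, hc, h0, ho, hu⟩ := h
  have key : ∀ (u : α → ℂ) (x : α' → ℂ), star (u ∘ e.symm) ⬝ᵥ x = star u ⬝ᵥ (x ∘ e) := by
    intro u x
    simp only [dotProduct, Pi.star_apply, Function.comp_apply]
    exact Fintype.sum_equiv e.symm _ _ (by simp)
  refine ⟨ι, _, fun i => a i ∘ e.symm, b, by rw [hc, Fintype.card_congr e], fun i => ⟨?_, (h0 i).2⟩,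
    fun i j hij => ?_, fun x y hxy => ?_⟩
  · intro h
    apply (h0 i).1
    funext p
    simpa using congrFun h (e p)
  · rw [key]
    convert ho i j hij using 3
    funext p
    simp
  · simp only [key] at hxy
    refine (hu _ _ hxy).imp_left fun h => ?_
    funext p
    simpa using congrFun h (e.symm p)

/-- The standard basis. -/
theorem zero : HasMissing α β 0 := by
  classical
  refine ⟨α × β, inferInstance, fun p => Pi.single p.1 1, fun p => Pi.single p.2 1, by simp,
    fun p => by simp, fun p q hpq => ?_, fun x y hxy => ?_⟩
  · by_cases h1 : p.1 = q.1
    · have h2 : p.2 ≠ q.2 := fun h => hpq (Prod.ext h1 h)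
      right
      simp [h2]
    · left
      simp [h1]
  · by_contra! h
    obtain ⟨p, hp⟩ := Function.ne_iff.1 h.1
    obtain ⟨q, hq⟩ := Function.ne_iff.1 h.2
    rcases hxy (p, q) with h | h
    · exact hp (by simpa [← Pi.single_star] using h)
    · exact hq (by simpa [← Pi.single_star] using h)

/-- Missing states numbers add up when two product families are placed side by side. -/
theorem sum (h : HasMissing α γ s) (h' : HasMissing β γ t) : HasMissing (α ⊕ β) γ (s + t) := by
  obtain ⟨ι, _, a, b, hc, h0, ho, hu⟩ := h
  obtain ⟨κ, _, a', b', hc', h0', ho', hu'⟩ := h'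
  refine ⟨ι ⊕ κ, inferInstance, Sum.elim (fun i => Sum.elim (a i) 0) (fun i => Sum.elim 0 (a' i)),
    Sum.elim b b', ?_, ?_, ?_, ?_⟩
  · simp only [Fintype.card_sum]
    rw [add_mul, ← hc, ← hc']
    ring
  · rintro (i | i)
    · refine ⟨fun h => (h0 i).1 ?_, (h0 i).2⟩
      funext p
      simpa using congrFun h (Sum.inl p)
    · refine ⟨fun h => (h0' i).1 ?_, (h0' i).2⟩
      funext p
      simpa using congrFun h (Sum.inr p)
  · rintro (i | i) (j | j) hij
    · simpa [dotProduct] using ho i j (by simpa using hij)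
    · simp [dotProduct]
    · simp [dotProduct]
    · simpa [dotProduct] using ho' i j (by simpa using hij)
  · intro x y hxy
    -- Both blocks see the same `y`; once it is nonzero, each block's own unextendibility kills its
    -- part of `x`.
    by_cases hy : y = 0
    · exact Or.inr hy
    have h1 := (hu (x ∘ Sum.inl) y fun i => by simpa [dotProduct] using hxy (Sum.inl i)).resolve_right hy
    have h2 := (hu' (x ∘ Sum.inr) y fun i => by simpa [dotProduct] using hxy (Sum.inr i)).resolve_right hy
    left
    funext p
    rcases p with p | p
    · exact congrFun h1 p
    · exact congrFun h2 p

theorem add_rows {n n' m : ℕ} (h : HasMissing (Fin n) (Fin m) s) (h' : HasMissing (Fin n') (Fin m) t) :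
    HasMissing (Fin (n + n')) (Fin m) (s + t) :=
  (h.sum h').congr_left finSumFinEquiv

theorem mono {n n' m m' : ℕ} (h : HasMissing (Fin n) (Fin m) t) (hn : n ≤ n') (hm : m ≤ m') :
    HasMissing (Fin n') (Fin m') t := by
  obtain ⟨p, rfl⟩ := Nat.exists_eq_add_of_le hn
  obtain ⟨q, rfl⟩ := Nat.exists_eq_add_of_le hm
  exact (((h.add_rows zero).swap).add_rows zero).swap

/-- Normalising the factors changes no orthogonality relation; `0 < t` gives the strict bound on the
number of states. -/
theorem exists_isUPB {n m : ℕ} (h : HasMissing (Fin n) (Fin m) t) (ht : 0 < t) :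
    ∃ (k : ℕ) (φ : Fin k → Bipartite n m), IsUPB φ ∧ missingStatesNumber φ = t := by
  obtain ⟨ι, _, a, b, hc, h0, ho, hu⟩ := h
  simp only [Fintype.card_fin] at hc
  have hinner : ∀ {d : ℕ} (u : Fin d → ℂ) (x : EuclideanSpace ℂ (Fin d)),
      inner ℂ (((‖WithLp.toLp 2 u‖ : ℂ)⁻¹) • WithLp.toLp 2 u) x = 0 ↔
        star u ⬝ᵥ x.ofLp = 0 ∨ u = 0 := by
    intro d u x
    rw [inner_smul_left, mul_eq_zero, EuclideanSpace.inner_eq_star_dotProduct, dotProduct_comm]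
    simp [or_comm]
  have hnorm : ∀ {d : ℕ} (u : Fin d → ℂ), u ≠ 0 →
      ‖((‖WithLp.toLp 2 u‖ : ℂ)⁻¹) • WithLp.toLp 2 u‖ = 1 := by
    intro d u hu
    rw [norm_smul, norm_inv, Complex.norm_real, norm_norm, inv_mul_cancel₀]
    simpa using hu
  let e := Fintype.equivFin ι
  let A : ι → EuclideanSpace ℂ (Fin n) := fun i => ((‖WithLp.toLp 2 (a i)‖ : ℂ)⁻¹) • WithLp.toLp 2 (a i)
  let B : ι → EuclideanSpace ℂ (Fin m) := fun i => ((‖WithLp.toLp 2 (b i)‖ : ℂ)⁻¹) • WithLp.toLp 2 (b i)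
  have hA : ∀ i x, inner ℂ (A i) x = 0 ↔ star (a i) ⬝ᵥ x.ofLp = 0 := fun i x => by
    rw [hinner]; simp [(h0 i).1]
  have hB : ∀ i x, inner ℂ (B i) x = 0 ↔ star (b i) ⬝ᵥ x.ofLp = 0 := fun i x => by
    rw [hinner]; simp [(h0 i).2]
  refine ⟨Fintype.card ι, fun k => A (e.symm k) ⊗ₜ[ℂ] B (e.symm k), ⟨by omega, fun k => ?_, ?_, ?_⟩, ?_⟩
  · exact ⟨_, _, hnorm _ (h0 _).1, hnorm _ (h0 _).2, rfl⟩
  · refine ⟨fun k => ?_, fun k l hkl => ?_⟩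
    · rw [TensorProduct.norm_tmul, hnorm _ (h0 _).1, hnorm _ (h0 _).2, one_mul]
    · change inner ℂ _ _ = 0
      rw [TensorProduct.inner_tmul, mul_eq_zero, hA, hB]
      refine (ho _ _ fun h => hkl (e.symm.injective h)).imp (fun h => ?_) (fun h => ?_)
      · simp [A, dotProduct_smul, h]
      · simp [B, dotProduct_smul, h]
  · rintro ψ hψ ⟨x, y, hx, hy, rfl⟩
    have := hu x.ofLp y.ofLp fun i => by
      have := hψ (e i)
      rwa [TensorProduct.inner_tmul, mul_eq_zero, hA, hB, Equiv.symm_apply_apply] at this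
    rcases this with h | h
    · have : x = 0 := by ext p; exact congrFun h p
      simp [this] at hx
    · have : y = 0 := by ext p; exact congrFun h p
      simp [this] at hy
  · rw [missingStatesNumber]
    omega

end HasMissing

/-! ### A decision procedure for integral product families -/

/-- The pairing of an integral coefficient list with a vector. -/
def evalRow {R : Type} [CommRing R] : List ℤ → List R → R
  | r :: l, x :: v => r * x + evalRow l v
  | _, _ => 0

/-- The coefficient list `c • l - d • l'`. -/
def subRow (c d : ℤ) : List ℤ → List ℤ → List ℤ
  | [], l' => l'.map fun r' => -(d * r')
  | r :: l, l' => (c * r - d * l'.headD 0) :: subRow c d l l'.tail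

/-- Gaussian elimination: whether the rows have full column rank `n`. -/
def fullRank : ℕ → List (List ℤ) → Bool
  | 0, _ => true
  | n + 1, rows =>
    match rows.find? (fun r => r.headD 0 != 0) with
    | none => false
    -- Fraction-free elimination. The pivot row stays in the list as a zero row, which is harmless.
    | some p => fullRank n (rows.map fun r => subRow (p.headD 0) (r.headD 0) r.tail p.tail)

/-- Whether each way of distributing the pairs `(a, b)` of `L` onto `A` (receiving `a`) and `B`
(receiving `b`) makes the rows in `A` or those in `B` have full column rank. -/
def splitsFullRank (n m : ℕ) : List (List ℤ × List ℤ) → List (List ℤ) → List (List ℤ) → Bool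
  | [], A, B => fullRank n A || fullRank m B
  -- Testing before splitting prunes every branch that is already decided.
  | p :: L, A, B => (fullRank n A || fullRank m B) ||
      (splitsFullRank n m L (p.1 :: A) B && splitsFullRank n m L A (p.2 :: B))

/-- Whether the pairs in `L` are nonzero, orthogonal as product vectors, and unextendible. -/
def isProductFamily (n m : ℕ) (L : List (List ℤ × List ℤ)) : Bool :=
  L.all (fun p => p.1.length == n && p.2.length == m &&
    evalRow p.1 p.1 != 0 && evalRow p.2 p.2 != 0) &&
  decide (L.Pairwise fun p q => evalRow p.1 q.1 = 0 ∨ evalRow p.2 q.2 = 0) &&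
  splitsFullRank n m L [] []

section

variable {R : Type} [CommRing R]

@[simp]
theorem evalRow_nil (v : List R) : evalRow [] v = 0 := by
  cases v <;> rfl

@[simp]
theorem evalRow_nil_right (l : List ℤ) : evalRow l ([] : List R) = 0 := by
  cases l <;> rfl

theorem evalRow_cons_right (l : List ℤ) (x : R) (v : List R) :
    evalRow l (x :: v) = l.headD 0 * x + evalRow l.tail v := by
  cases l <;> simp [evalRow]

theorem evalRow_subRow (c d : ℤ) (l l' : List ℤ) (v : List R) :
    evalRow (subRow c d l l') v = c * evalRow l v - d * evalRow l' v := by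
  induction v generalizing l l' with
  | nil => simp
  | cons x v ih =>
    rcases l with _ | ⟨r, l⟩
    · rcases l' with _ | ⟨r', l'⟩
      · simp [subRow]
      · have := ih [] l'
        simp only [subRow, evalRow_nil] at this
        simp only [subRow, List.map_cons, evalRow, this]
        push_cast
        ring
    · rw [evalRow_cons_right l']
      simp only [subRow, evalRow, ih]
      push_cast
      ring

theorem evalRow_ofFn (l : List ℤ) {n : ℕ} (x : Fin n → R) :
    evalRow l (List.ofFn x) = ∑ i : Fin n, (l.getD i 0 : R) * x i := by
  induction n generalizing l with
  | zero => simp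
  | succ n ih =>
    rw [List.ofFn_succ, evalRow_cons_right, ih, Fin.sum_univ_succ]
    cases l <;> simp

theorem cast_evalRow (l l' : List ℤ) :
    ((evalRow l l' : ℤ) : R) = evalRow l (l'.map (Int.cast : ℤ → R)) := by
  induction l' generalizing l with
  | nil => simp
  | cons x l' ih => simp [evalRow_cons_right, ih]

theorem eq_zero_of_fullRank [IsDomain R] [CharZero R] {rows : List (List ℤ)} {v : List R}
    (h : fullRank v.length rows = true) (hv : ∀ r ∈ rows, evalRow r v = 0) : ∀ x ∈ v, x = 0 := by
  induction v generalizing rows with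
  | nil => simp
  | cons x v ih =>
    rw [List.length_cons, fullRank] at h
    split at h
    · simp at h
    · rename_i p hp
      have hp0 : p.headD 0 ≠ 0 := by simpa using List.find?_some hp
      have hpv := hv p (List.mem_of_find?_eq_some hp)
      rw [evalRow_cons_right] at hpv
      have htail : ∀ y ∈ v, y = 0 := by
        refine ih h fun r hr => ?_
        obtain ⟨q, hq, rfl⟩ := List.mem_map.1 hr
        have hqv := hv q hq
        rw [evalRow_cons_right] at hqv
        rw [evalRow_subRow]
        linear_combination (p.headD 0 : R) * hqv - (q.headD 0 : R) * hpv
      have hzero : evalRow p.tail v = 0 := by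
        rw [List.eq_replicate_of_mem htail]
        generalize v.length = k
        generalize p.tail = l
        induction k generalizing l with
        | zero => simp
        | succ k ih => simp [List.replicate_succ, evalRow_cons_right, ih]
      rw [hzero, add_zero] at hpv
      rintro y (_ | ⟨_, hy⟩)
      · exact (mul_eq_zero.1 hpv).resolve_left (by exact_mod_cast hp0)
      · exact htail y hy

/-- A product vector orthogonal to the family chooses, for each member, a factor in which
orthogonality holds. Following these choices down the tree ends at a full-rank side, where the
corresponding factor must vanish. -/
theorem eq_zero_of_splitsFullRank [IsDomain R] [CharZero R] {v w : List R}
    {L : List (List ℤ × List ℤ)} {A B : List (List ℤ)}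
    (h : splitsFullRank v.length w.length L A B = true)
    (hA : ∀ r ∈ A, evalRow r v = 0) (hB : ∀ r ∈ B, evalRow r w = 0)
    (hL : ∀ p ∈ L, evalRow p.1 v = 0 ∨ evalRow p.2 w = 0) :
    (∀ x ∈ v, x = 0) ∨ ∀ y ∈ w, y = 0 := by
  have base : ∀ {A B : List (List ℤ)}, (∀ r ∈ A, evalRow r v = 0) → (∀ r ∈ B, evalRow r w = 0) →
      (fullRank v.length A || fullRank w.length B) = true →
      (∀ x ∈ v, x = 0) ∨ ∀ y ∈ w, y = 0 := by
    intro A B hA hB h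
    exact (Bool.or_eq_true _ _ ▸ h).imp (fun h => eq_zero_of_fullRank h hA)
      (fun h => eq_zero_of_fullRank h hB)
  induction L generalizing A B with
  | nil => exact base hA hB h
  | cons p L ih =>
    rw [splitsFullRank, Bool.or_eq_true, Bool.and_eq_true] at h
    rcases h with h | ⟨h1, h2⟩
    · exact base hA hB h
    · have hL' := fun q hq => hL q (List.mem_cons_of_mem p hq)
      rcases hL p List.mem_cons_self with hp | hp
      · exact ih h1 (List.forall_mem_cons.2 ⟨hp, hA⟩) hB hL'
      · exact ih h2 hA (List.forall_mem_cons.2 ⟨hp, hB⟩) hL'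

end

/-- The vector with integral coordinates `l`. -/
def rowVec (n : ℕ) (l : List ℤ) : Fin n → ℂ := fun i => (l.getD i 0 : ℂ)

theorem star_rowVec_dotProduct {n : ℕ} (l : List ℤ) (x : Fin n → ℂ) :
    star (rowVec n l) ⬝ᵥ x = evalRow l (List.ofFn x) := by
  simp [evalRow_ofFn, dotProduct, rowVec]

theorem star_rowVec_dotProduct_rowVec (l : List ℤ) {n : ℕ} {l' : List ℤ} (h : l'.length = n) :
    star (rowVec n l) ⬝ᵥ rowVec n l' = (evalRow l l' : ℤ) := by
  subst h
  rw [star_rowVec_dotProduct, cast_evalRow]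
  congr 1
  apply List.ext_getElem
  · simp
  · intro i h1 h2
    simp at h1
    simp [rowVec, h1]

/-- Integer coordinates are fixed by conjugation, so the complex inner products are the integer
pairings. -/
theorem hasMissing_of_isProductFamily {n m : ℕ} (t : ℕ) (L : List (List ℤ × List ℤ))
    (h : isProductFamily n m L = true) (ht : L.length + t = n * m) :
    HasMissing (Fin n) (Fin m) t := by
  simp only [isProductFamily, Bool.and_eq_true, List.all_eq_true, decide_eq_true_eq, beq_iff_eq,
    bne_iff_ne] at h
  obtain ⟨⟨hL, ho⟩, hs⟩ := h
  have hL' := fun i : Fin L.length => hL _ (List.get_mem L i)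
  have key : ∀ i j : Fin L.length, i < j → evalRow (L.get i).1 (L.get j).1 = 0 ∨
      evalRow (L.get i).2 (L.get j).2 = 0 := fun i j hij => List.pairwise_iff_get.1 ho i j hij
  have hd : ∀ {d : ℕ} (l l' : List ℤ), l.length = d → l'.length = d → evalRow l l' = 0 →
      star (rowVec d l) ⬝ᵥ rowVec d l' = 0 ∧ star (rowVec d l') ⬝ᵥ rowVec d l = 0 := by
    intro d l l' hl hl' h
    have h1 : star (rowVec d l) ⬝ᵥ rowVec d l' = 0 := by
      rw [star_rowVec_dotProduct_rowVec l hl', h, Int.cast_zero]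
    refine ⟨h1, ?_⟩
    rw [← star_eq_zero, Matrix.star_dotProduct]
    simpa using h1
  have hne : ∀ {d : ℕ} (l : List ℤ), l.length = d → evalRow l l ≠ 0 → rowVec d l ≠ 0 := by
    intro d l hl h h0
    apply h
    have := star_rowVec_dotProduct_rowVec l hl
    rw [h0, dotProduct_zero] at this
    exact_mod_cast this.symm
  refine ⟨Fin L.length, inferInstance, fun i => rowVec n (L.get i).1, fun i => rowVec m (L.get i).2,
    by simpa using ht, fun i => ⟨hne _ (hL' i).1.1.1 (hL' i).1.2, hne _ (hL' i).1.1.2 (hL' i).2⟩,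
    fun i j hij => ?_, fun x y hxy => ?_⟩
  · rcases lt_or_gt_of_ne hij with h | h
    · exact (key i j h).imp (fun h => (hd _ _ (hL' i).1.1.1 (hL' j).1.1.1 h).1)
        (fun h => (hd _ _ (hL' i).1.1.2 (hL' j).1.1.2 h).1)
    · exact (key j i h).imp (fun h => (hd _ _ (hL' j).1.1.1 (hL' i).1.1.1 h).2)
        (fun h => (hd _ _ (hL' j).1.1.2 (hL' i).1.1.2 h).2)
  · simp only [star_rowVec_dotProduct] at hxy
    have := eq_zero_of_splitsFullRank (v := List.ofFn x) (w := List.ofFn y) (L := L) (A := [])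
      (B := []) (by simpa using hs) (by simp) (by simp) fun p hp => by
        obtain ⟨i, rfl⟩ := List.get_of_mem hp
        exact hxy i
    simpa [funext_iff, List.mem_ofFn] using this

/-! ### Explicit small product families -/

/-- A tile construction: four dominoes, each carrying a difference vector, cover all cells of the
grid but one, and the all-ones vector blocks extension. The 3 × 4 family with 5 missing and the 4 ×
4 family with 7 missing are domino tilings of the whole grid plus the all-ones vector. -/
theorem hasMissing_three_three_four : HasMissing (Fin 3) (Fin 3) 4 :=
  hasMissing_of_isProductFamily 4
    [([1, 0, -1], [0, 0, 1]), ([0, 1, -1], [1, 0, 0]), ([0, 1, 0], [0, 1, -1]),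
      ([1, 0, 0], [1, -1, 0]), ([1, 1, 1], [1, 1, 1])]
    (by decide +kernel) (by decide)

theorem hasMissing_three_four_five : HasMissing (Fin 3) (Fin 4) 5 :=
  hasMissing_of_isProductFamily 5
    [([0, -1, 1], [0, 0, 0, 1]), ([-1, 1, 0], [1, 0, 0, 0]), ([1, 0, 0], [0, -1, 0, 1]),
      ([0, 0, 1], [1, -1, 0, 0]), ([0, 1, 0], [0, 1, -1, 0]), ([-1, 0, 1], [0, 0, 1, 0]),
      ([1, 1, 1], [1, 1, 1, 1])]
    (by decide +kernel) (by decide)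

/-- This has n + m - 1 members, the fewest possible: with fewer, n - 1 conditions on one factor and
m - 1 on the other could always be met. Hence (n - 1)(m - 1) states are missing. -/
theorem hasMissing_three_four_six : HasMissing (Fin 3) (Fin 4) 6 :=
  hasMissing_of_isProductFamily 6
    [([0, 0, 1], [-1, 0, -1, 0]), ([-1, 1, 0], [0, -1, 1, 0]), ([-1, -1, 1], [0, -1, 0, 1]),
      ([2, -1, 1], [0, 0, 0, -1]), ([0, 1, 0], [1, 0, 0, 0]), ([-1, 0, 2], [-1, 1, 1, 1])]
    (by decide +kernel) (by decide)

theorem hasMissing_three_five_eight : HasMissing (Fin 3) (Fin 5) 8 :=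
  hasMissing_of_isProductFamily 8
    [([1, 0, 2], [-1, 1, 0, 0, 0]), ([1, 0, 1], [1, 1, 0, 1, 0]), ([0, 1, 0], [0, -1, 0, 0, 0]),
      ([-1, -2, 0], [0, 0, 1, 0, 1]), ([2, -1, 1], [0, 0, 1, 0, 0]),
      ([-1, -1, 1], [0, 0, 1, 1, -1]), ([-2, 1, 1], [-1, 0, 0, 1, 1])]
    (by decide +kernel) (by decide)

theorem hasMissing_three_seven_twelve : HasMissing (Fin 3) (Fin 7) 12 :=
  hasMissing_of_isProductFamily 12
    [([1, 0, -1], [0, 0, 0, 0, 0, 1, 0]), ([1, -1, 1], [0, 0, 0, -1, 1, -1, -1]),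
      ([2, 1, -1], [0, 0, 1, 0, 0, 0, -1]), ([-1, 2, 0], [0, 0, 1, 0, 0, 0, 0]),
      ([2, 1, 0], [1, 1, 1, -1, 0, 0, 1]), ([1, -2, -1], [0, 1, 0, 0, 0, 0, 0]),
      ([-3, -1, -1], [-1, 1, 0, 0, 0, 0, 0]), ([-2, 3, 3], [1, 0, 0, 1, 1, 0, 0]),
      ([3, -1, 3], [0, 0, 0, 0, 1, 1, 0])]
    (by decide +kernel) (by decide)

theorem hasMissing_four_four_seven : HasMissing (Fin 4) (Fin 4) 7 :=
  hasMissing_of_isProductFamily 7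
    [([0, 0, 1, 0], [-1, 0, 1, 0]), ([0, 0, 0, 1], [0, 1, 0, -1]), ([-1, 0, 1, 0], [0, 0, 0, 1]),
      ([0, 1, 0, 0], [0, 0, 1, -1]), ([1, 0, 0, 0], [1, -1, 0, 0]), ([0, 1, -1, 0], [0, 1, 0, 0]),
      ([1, 0, 0, -1], [0, 0, 1, 0]), ([0, -1, 0, 1], [1, 0, 0, 0]), ([1, 1, 1, 1], [1, 1, 1, 1])]
    (by decide +kernel) (by decide)

theorem hasMissing_four_four_eight : HasMissing (Fin 4) (Fin 4) 8 :=
  hasMissing_of_isProductFamily 8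
    [([0, 0, -1, 1], [-1, 0, 1, 0]), ([1, -1, 0, 1], [1, 0, 1, 0]), ([1, 1, 0, 0], [0, 0, 1, 1]),
      ([1, 0, 0, 0], [1, 1, -1, 1]), ([0, 0, -1, 0], [0, 0, 0, 1]),
      ([0, 1, 0, 1], [-1, -1, -1, 1]), ([1, 0, -1, -1], [-1, 1, 0, 0]),
      ([0, -1, -1, 1], [0, 1, 0, 0])]
    (by decide +kernel) (by decide)

theorem hasMissing_four_five_twelve : HasMissing (Fin 4) (Fin 5) 12 :=
  hasMissing_of_isProductFamily 12
    [([0, 1, 1, 0], [1, 1, 0, 1, 0]), ([2, 3, 0, -1], [0, 0, 1, 0, 0]),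
      ([1, 0, -1, 2], [0, 1, 1, -1, 0]), ([0, -1, 1, 1], [-1, 0, 0, 0, 1]),
      ([-1, 1, 1, 1], [1, -1, -1, 0, 1]), ([0, -1, 1, 0], [-1, 1, 0, 1, -1]),
      ([1, 1, 1, 0], [0, 1, 0, -1, 1]), ([-1, 2, -2, 4], [0, 0, 1, 1, 1])]
    (by decide +kernel) (by decide)

theorem hasMissing_five_five_sixteen : HasMissing (Fin 5) (Fin 5) 16 :=
  hasMissing_of_isProductFamily 16
    [([1, 2, -4, -2, 3], [-1, 2, 1, 1, 0]), ([-1, -1, 1, -2, 1], [2, 1, -1, 0, 1]),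
      ([0, 0, -1, -1, 1], [-1, 0, -1, 0, 1]), ([0, -1, 0, 0, -1], [1, 1, -1, 0, 0]),
      ([-1, 0, 1, -1, 1], [-1, 3, 2, 2, 1]), ([-1, 1, 0, -1, -1], [0, 1, 0, -1, -1]),
      ([0, -1, 0, 1, 1], [5, 2, -1, 2, 0]), ([2, 0, 1, -1, 0], [-1, 1, -1, 1, 0]),
      ([-2, -1, -1, 1, 0], [0, 0, 0, 0, 1])]
    (by decide +kernel) (by decide)

/-! ### Combining blocks -/

/-- `T` is a missing states number, and each `t ≤ T` exceeds some missing states number by at most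
three. -/
def DenseUpTo (n m T : ℕ) : Prop :=
  HasMissing (Fin n) (Fin m) T ∧
    ∀ t ≤ T, ∃ c, HasMissing (Fin n) (Fin m) c ∧ c ≤ t ∧ t ≤ c + 3

/-- All numbers from `8` to `T` are missing states numbers. -/
def FillsUpTo (n m T : ℕ) : Prop :=
  ∀ t, 8 ≤ t → t ≤ T → HasMissing (Fin n) (Fin m) t

section

variable {n n' m m' S T : ℕ}

namespace DenseUpTo

theorem swap (h : DenseUpTo n m T) : DenseUpTo m n T :=
  ⟨h.1.swap, fun t ht => (h.2 t ht).imp fun _ hc => ⟨hc.1.swap, hc.2⟩⟩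

theorem of_le_add_four (h : DenseUpTo n m S) (hT : HasMissing (Fin n) (Fin m) T) (hST : T ≤ S + 4) :
    DenseUpTo n m T := by
  refine ⟨hT, fun t ht => ?_⟩
  rcases le_or_gt t S with h' | h'
  · exact h.2 t h'
  · rcases ht.lt_or_eq with h'' | rfl
    · exact ⟨S, h.1, by omega, by omega⟩
    · exact ⟨t, hT, by omega, by omega⟩

theorem zero : DenseUpTo n m 0 :=
  ⟨.zero, fun t ht => ⟨0, .zero, by omega, by omega⟩⟩

theorem add_rows (h : DenseUpTo n m S) (h' : DenseUpTo n' m T) : DenseUpTo (n + n') m (S + T) := by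
  refine ⟨h.1.add_rows h'.1, fun t ht => ?_⟩
  rcases le_or_gt t S with hS | hS
  · obtain ⟨c, hc, h1, h2⟩ := h.2 t hS
    exact ⟨c, hc.mono (by omega) le_rfl, h1, h2⟩
  · obtain ⟨c, hc, h1, h2⟩ := h'.2 (t - S) (by omega)
    exact ⟨S + c, h.1.add_rows hc, by omega, by omega⟩

theorem add_cols (h : DenseUpTo n m S) (h' : DenseUpTo n m' T) : DenseUpTo n (m + m') (S + T) :=
  (h.swap.add_rows h'.swap).swap

end DenseUpTo

namespace FillsUpTo

theorem swap (h : FillsUpTo n m T) : FillsUpTo m n T := fun t h1 h2 => (h t h1 h2).swap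

theorem mono (h : FillsUpTo n m T) (hn : n ≤ n') (hm : m ≤ m') (hS : S ≤ T) : FillsUpTo n' m' S :=
  fun t h1 h2 => (h t h1 (h2.trans hS)).mono hn hm

/-- For `t ≤ T + 8`, approximate `t - 8` from below by a value `c` of the second block; the
remainder `t - c` lies in the window 8 to 11, which `11 ≤ S` makes available. Larger `t` use all of
`T`. -/
theorem add_rows (h : FillsUpTo n m S) (hS : 11 ≤ S) (h' : DenseUpTo n' m T) :
    FillsUpTo (n + n') m (S + T) := by
  intro t h1 h2
  rcases le_or_gt (t - 8) T with hT | hT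
  · obtain ⟨c, hc, h3, h4⟩ := h'.2 (t - 8) hT
    have := (h (t - c) (by omega) (by omega)).add_rows hc
    rwa [Nat.sub_add_cancel (by omega)] at this
  · have := (h (t - T) (by omega) (by omega)).add_rows h'.1
    rwa [Nat.sub_add_cancel (by omega)] at this

theorem add_cols (h : FillsUpTo n m S) (hS : 11 ≤ S) (h' : DenseUpTo n m' T) :
    FillsUpTo n (m + m') (S + T) :=
  (h.swap.add_rows hS h'.swap).swap

end FillsUpTo

/-! ### Ranges attained by the small blocks -/

theorem hasMissing_three_four {t : ℕ} (h4 : 4 ≤ t) (h6 : t ≤ 6) : HasMissing (Fin 3) (Fin 4) t := by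
  interval_cases t
  · exact hasMissing_three_three_four.mono (by norm_num) (by norm_num)
  · exact hasMissing_three_four_five
  · exact hasMissing_three_four_six

theorem hasMissing_four_four {t : ℕ} (h4 : 4 ≤ t) (h8 : t ≤ 8) : HasMissing (Fin 4) (Fin 4) t := by
  rcases le_or_gt t 6 with h | h
  · exact (hasMissing_three_four h4 h).mono (by norm_num) le_rfl
  interval_cases t
  · exact hasMissing_four_four_seven
  · exact hasMissing_four_four_eight

theorem denseUpTo_three_three : DenseUpTo 3 3 4 :=
  DenseUpTo.zero.of_le_add_four hasMissing_three_three_four (by norm_num)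

theorem denseUpTo_three_four : DenseUpTo 3 4 6 :=
  (DenseUpTo.zero.of_le_add_four (hasMissing_three_four le_rfl (by norm_num)) le_rfl).of_le_add_four
    hasMissing_three_four_six (by norm_num)

theorem denseUpTo_three_five : DenseUpTo 3 5 8 :=
  (DenseUpTo.zero.of_le_add_four (hasMissing_three_three_four.mono le_rfl (by norm_num))
    le_rfl).of_le_add_four hasMissing_three_five_eight le_rfl

theorem denseUpTo_three_seven : DenseUpTo 3 7 12 :=
  ((DenseUpTo.zero.of_le_add_four (hasMissing_three_three_four.mono le_rfl (by norm_num))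
    le_rfl).of_le_add_four (hasMissing_three_five_eight.mono le_rfl (by norm_num))
    le_rfl).of_le_add_four hasMissing_three_seven_twelve le_rfl

theorem denseUpTo_four_four : DenseUpTo 4 4 8 :=
  (DenseUpTo.zero.of_le_add_four (hasMissing_four_four le_rfl (by norm_num)) le_rfl).of_le_add_four
    hasMissing_four_four_eight le_rfl

theorem denseUpTo_four_five : DenseUpTo 4 5 12 :=
  ((DenseUpTo.zero.of_le_add_four (hasMissing_three_three_four.mono (by norm_num) (by norm_num))
    le_rfl).of_le_add_four (hasMissing_three_five_eight.mono (by norm_num) le_rfl)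
    le_rfl).of_le_add_four hasMissing_four_five_twelve le_rfl

theorem denseUpTo_five_five : DenseUpTo 5 5 16 :=
  (((DenseUpTo.zero.of_le_add_four (hasMissing_three_three_four.mono (by norm_num) (by norm_num))
    le_rfl).of_le_add_four (hasMissing_three_five_eight.mono (by norm_num) le_rfl)
    le_rfl).of_le_add_four (hasMissing_four_five_twelve.mono (by norm_num) le_rfl)
    le_rfl).of_le_add_four hasMissing_five_five_sixteen le_rfl

/-- The bound 2m is half the dimension 4m, exactly what nm/2 gains from four rows. Columns come off
three at a time because 4 × 3 already attains 6. -/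
theorem denseUpTo_four (m : ℕ) (hm : 3 ≤ m) : ∃ T, 2 * m ≤ T ∧ DenseUpTo 4 m T := by
  induction m using Nat.strong_induction_on with
  | _ m ih =>
    rcases le_or_gt m 5 with h | h
    · interval_cases m
      · exact ⟨6, le_rfl, denseUpTo_three_four.swap⟩
      · exact ⟨8, le_rfl, denseUpTo_four_four⟩
      · exact ⟨12, by norm_num, denseUpTo_four_five⟩
    · obtain ⟨T, hT, hd⟩ := ih (m - 3) (by omega) (by omega)
      refine ⟨T + 6, by omega, ?_⟩
      have := hd.add_cols denseUpTo_three_four.swap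
      rwa [Nat.sub_add_cancel (by omega)] at this

theorem fillsUpTo_three_eight : FillsUpTo 3 8 12 := by
  intro t h1 h2
  have key : ∀ a b, 4 ≤ a → a ≤ 6 → 4 ≤ b → b ≤ 6 → HasMissing (Fin 3) (Fin 8) (a + b) :=
    fun a b ha ha' hb hb' =>
      ((hasMissing_three_four ha ha').swap.add_rows (hasMissing_three_four hb hb').swap).swap
  convert key (t / 2) (t - t / 2) (by omega) (by omega) (by omega) (by omega) using 1
  omega

theorem fillsUpTo_four_seven : FillsUpTo 4 7 14 := by
  intro t h1 h2
  have key : ∀ a b, 4 ≤ a → a ≤ 6 → 4 ≤ b → b ≤ 8 → HasMissing (Fin 4) (Fin 7) (a + b) :=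
    fun a b ha ha' hb hb' =>
      ((hasMissing_three_four ha ha').add_rows (hasMissing_four_four hb hb')).swap
  -- The first summand is as large as its block allows while leaving at least 4 for the second.
  convert key (min 6 (t - 4)) (t - min 6 (t - 4)) (by omega) (by omega) (by omega) (by omega) using 1
  omega

theorem fillsUpTo_eight_four : FillsUpTo 8 4 16 := by
  intro t h1 h2
  have key : ∀ a b, 4 ≤ a → a ≤ 8 → 4 ≤ b → b ≤ 8 → HasMissing (Fin 8) (Fin 4) (a + b) :=
    fun a b ha ha' hb hb' => (hasMissing_four_four ha ha').add_rows (hasMissing_four_four hb hb')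
  convert key (t / 2) (t - t / 2) (by omega) (by omega) (by omega) (by omega) using 1
  omega

theorem denseUpTo_seven_three : DenseUpTo 7 3 10 :=
  denseUpTo_three_three.add_rows denseUpTo_three_four.swap

theorem denseUpTo_seven_five : DenseUpTo 7 5 20 :=
  denseUpTo_three_five.add_rows denseUpTo_four_five

theorem denseUpTo_eight_five : DenseUpTo 8 5 24 :=
  denseUpTo_four_five.add_rows denseUpTo_four_five

theorem denseUpTo_five_eight : DenseUpTo 5 8 24 :=
  denseUpTo_five_five.add_cols denseUpTo_three_five.swap

theorem denseUpTo_five_ten : DenseUpTo 5 10 32 :=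
  denseUpTo_five_five.add_cols denseUpTo_five_five

theorem fillsUpTo_seven_seven : FillsUpTo 7 7 26 :=
  fillsUpTo_four_seven.add_rows (by norm_num) denseUpTo_three_seven

theorem fillsUpTo_four_ten : FillsUpTo 4 10 20 :=
  fillsUpTo_four_seven.add_cols (by norm_num) denseUpTo_three_four.swap

/-- All numbers from `8` to `nm / 2 + 1` are missing states numbers. -/
def FillsHalf (n m : ℕ) : Prop := FillsUpTo n m (n * m / 2 + 1)

theorem FillsHalf.swap (h : FillsHalf n m) : FillsHalf m n := by
  rw [FillsHalf, mul_comm]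
  exact FillsUpTo.swap h

theorem FillsHalf.add_four_rows (hn : 7 ≤ n) (hm : 7 ≤ m) (h : FillsHalf n m) :
    FillsHalf (n + 4) m := by
  obtain ⟨T, hT, hd⟩ := denseUpTo_four m (by omega)
  -- Ensures nm/2 + 1 ≥ 11, so the four-value window is present.
  have : 7 * 7 ≤ n * m := Nat.mul_le_mul hn hm
  refine (FillsUpTo.add_rows h (by omega) hd).mono le_rfl le_rfl ?_
  rw [add_mul]
  omega

/-- Each grid is cut into one block with a full range and others with bounded gaps. Blocks such as 3
× 7, 4 × 5 and 5 × 5, which exceed half their dimension, supply the extra 1; 7 × 10 meets the bound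
with equality. -/
theorem fillsHalf_of_le (hn : 7 ≤ n) (hnm : n ≤ m) (hm : m ≤ 10) : FillsHalf n m := by
  rw [FillsHalf]
  have hn' := hnm.trans hm
  interval_cases n <;> interval_cases m
  · exact fillsUpTo_seven_seven.mono le_rfl le_rfl (by norm_num)
  · exact (fillsUpTo_three_eight.add_rows (by norm_num)
      (denseUpTo_four_five.add_cols denseUpTo_three_four.swap)).mono le_rfl le_rfl (by norm_num)
  · exact (fillsUpTo_four_seven.swap.add_cols (by norm_num) denseUpTo_seven_five).mono le_rfl le_rfl
      (by norm_num)
  · exact fillsUpTo_seven_seven.add_cols (by norm_num) denseUpTo_seven_three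
  · exact (fillsUpTo_three_eight.add_rows (by norm_num) denseUpTo_five_eight).mono le_rfl le_rfl
      (by norm_num)
  · exact (fillsUpTo_eight_four.add_cols (by norm_num) denseUpTo_eight_five).mono le_rfl le_rfl
      (by norm_num)
  · exact (fillsUpTo_three_eight.swap.add_cols (by norm_num)
      (denseUpTo_seven_five.add_cols denseUpTo_seven_three).swap).mono le_rfl le_rfl (by norm_num)
  · exact ((fillsUpTo_eight_four.mono (n' := 9) (by norm_num) le_rfl le_rfl).add_cols (by norm_num)
      (denseUpTo_four_five.add_rows denseUpTo_five_five)).mono le_rfl le_rfl (by norm_num)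
  · exact (fillsUpTo_four_ten.add_rows (by norm_num) denseUpTo_five_ten).mono le_rfl le_rfl
      (by norm_num)
  -- Nine of the ten rows already reach 52, above the required 51.
  · exact (fillsUpTo_four_ten.add_rows (by norm_num) denseUpTo_five_ten).mono (by norm_num) le_rfl
      (by norm_num)

theorem fillsHalf_of_le_ten (hn : 7 ≤ n) (hm : 7 ≤ m) (hm' : m ≤ 10) : FillsHalf n m := by
  induction n using Nat.strong_induction_on with
  | _ n ih =>
    rcases le_or_gt n 10 with h | h
    · rcases le_total n m with h' | h'
      · exact fillsHalf_of_le hn h' hm'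
      · exact (fillsHalf_of_le hm h' h).swap
    · have := (ih (n - 4) (by omega) (by omega)).add_four_rows (by omega) hm
      rwa [Nat.sub_add_cancel (by omega)] at this

theorem fillsHalf (hn : 7 ≤ n) (hm : 7 ≤ m) : FillsHalf n m := by
  induction m using Nat.strong_induction_on with
  | _ m ih =>
    rcases le_or_gt m 10 with h | h
    · exact fillsHalf_of_le_ten hn hm h
    · have := ((ih (m - 4) (by omega) (by omega)).swap.add_four_rows (by omega) hn).swap
      rwa [Nat.sub_add_cancel (by omega)] at this

end

theorem theorem3 (n m : ℕ) (hn : 7 ≤ n) (hnm : n ≤ m) (hmn : m ≤ n + 1)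
    (t : ℕ) (ht : 4 ≤ t) (ht' : t ≤ m * n / 2 + 1) :
    ∃ (k : ℕ) (φ : Fin k → Bipartite n m), IsUPB φ ∧ missingStatesNumber φ = t := by
  refine HasMissing.exists_isUPB ?_ (by omega)
  rcases le_or_gt t 8 with h | h
  · exact (hasMissing_four_four ht h).mono (by omega) (by omega)
  · exact fillsHalf hn (hn.trans hnm) t h.le (by rwa [mul_comm])
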